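/- Let $\langle L_\alpha:\alpha\in On\rangle$ be the constructible hierarchy: $L_0=\emptyset$; $L_{\beta+1}$ is the set of subsets of $L_\beta$ that are first-order definable over $\langle L_\beta,\in\rangle$ with parameters from $L_\beta$; and $L_\lambda=\bigcup_{\beta<\lambda}L_\beta$ for limit $\lambda$. An element $a\in\mathbb{N}^{\mathbb{N}}$ is identified with its graph, a set of ordered pairs of von Neumann natural numbers, and for $n\in\mathbb{N}$ its $n$-th projection $a_n\in\mathbb{N}^{\mathbb{N}}$ is $a_n(m)=a(2^n(2m+1))$. Codes. (i) $f\in\mathbb{N}^{\mathbb{N}}$ codes the real number $r$ if $f(m+2)\in\{0,1\}$ for all $m\ge 0$ and $r=f(0)-f(1)+\sum_{m\ge 0}f(m+2)2^{-(m+1)}$. (ii) $y\in\mathbb{N}^{\mathbb{N}}$ codes the sequence of reals $\{y_n\}_{n\in\mathbb{N}}$ if for every $n\ge 0$ the $n$-th projection of $y$ codes the real $y_n$. (iii) Let $I_0,I_1,\dots$ be the effective enumeration of the bounded open intervals with rational endpoints given by $I_n=\big(\tfrac{a-b}{d+1},\tfrac{a-b+e+1}{d+1}\big)$ for $n=\langle\langle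 a,b\rangle,\langle d,e\rangle\rangle$, where $\langle i,j\rangle=j^2+i$ if $i<j$ and $\langle i,j\rangle=i^2+i+j$ otherwise. Then $a\in\mathbb{N}^{\mathbb{N}}$ codes the open set $G(a)=\bigcup\{I_n: a(n)=1\}\subseteq\mathbb{R}$. For an ordinal $\alpha$, let $\mathcal{G}_\alpha$ be the family of open sets $G\subseteq\mathbb{R}$ with $\mathbb{Q}\subseteq G$ that have a code in $\mathbb{N}^{\mathbb{N}}\cap L_\alpha$. **Theorem 1E.** Let $\alpha$ be an ordinal, let $y\in\mathbb{N}^{\mathbb{N}}\cap L_\alpha$ code a sequence of reals $\{y_n\}_{n\in\mathbb{N}}$ that converges (in the Euclidean topology) to its term $y_0$, and let $x\in\mathbb{N}^{\mathbb{N}}\cap L_\alpha$ be such that $G_n:=G(x_n)\in\mathcal{G}_\alpha$ for every $n\in\mathbb{N}$. Put $T=\bigcap_{n\in\mathbb{N}}G_n$. Then there are a real number $c$ and $M\in\mathbb{N}$ such that $$y_0+c\in T\qquad\text{and}\qquad y_m+c\in T\ \text{ for all } m>M,$$ and $c$ has a code in $\mathbb{N}^{\mathbb{N}}\cap L_{\alpha+\omega}$.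 -/

import Mathlib

universe u

/-! ### The constructible hierarchy -/

/-- The only non-logical symbol of the language of set theory: the binary relation `∈`. -/
inductive MemRel : ℕ → Type
  | mem : MemRel 2

/-- The first-order language of set theory (equality is a logical symbol). -/
def LST : FirstOrder.Language.{0, 0} := ⟨fun _ => Empty, MemRel⟩

/-- A set `A` as a structure `⟨A, ∈⟩` for the language of set theory. -/
instance setStructure (A : ZFSet.{u}) : LST.Structure {z : ZFSet.{u} // z ∈ A} where
  funMap := fun f => Empty.elim f
  RelMap := fun R v => match R, v with
    | MemRel.mem, v => (v 0).1 ∈ (v 1).1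

/-- `defPowerset A` is the set of those subsets of `A` which are definable over `⟨A, ∈⟩` by a
first-order formula with parameters from `A`. -/
noncomputable def defPowerset (A : ZFSet.{u}) : ZFSet.{u} :=
  ZFSet.sep (fun s => (Set.univ : Set {z : ZFSet.{u} // z ∈ A}).Definable₁ LST {z | z.1 ∈ s})
    (ZFSet.powerset A)

/-- The levels `L_α` of the constructible hierarchy. -/
noncomputable def constructibleLevel (α : Ordinal.{u}) : ZFSet.{u} :=
  Ordinal.limitRecOn α ∅ (fun _ A => defPowerset A)
    (fun β _ L => ZFSet.iUnion (fun γ : Set.Iio β => L γ.1 γ.2))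

theorem constructibleLevel_zero : constructibleLevel.{u} 0 = ∅ :=
  Ordinal.limitRecOn_zero _ _ _

theorem constructibleLevel_add_one (β : Ordinal.{u}) :
    constructibleLevel (β + 1) = defPowerset (constructibleLevel β) :=
  Ordinal.limitRecOn_add_one _ _ _ _

theorem constructibleLevel_limit (β : Ordinal.{u}) (h : Order.IsSuccLimit β) :
    constructibleLevel β = ZFSet.iUnion (fun γ : Set.Iio β => constructibleLevel γ.1) :=
  Ordinal.limitRecOn_limit _ _ _ _ h

/-! ### Codes -/

/-- The element of Baire space `f : ℕ → ℕ` as a set: its graph, made of Kuratowski pairs of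
von Neumann natural numbers. -/
noncomputable def baireSet (f : ℕ → ℕ) : ZFSet.{u} :=
  ZFSet.range (fun n : ℕ =>
    ZFSet.pair (Ordinal.toZFSet (n : Ordinal.{u})) (Ordinal.toZFSet ((f n : ℕ) : Ordinal.{u})))

/-- `f ∈ ℕ^ℕ ∩ L_α`. -/
def InLevel (α : Ordinal.{u}) (f : ℕ → ℕ) : Prop := baireSet.{u} f ∈ constructibleLevel α

/-- The `n`-th projection `a_n` of `a`. -/
def proj (a : ℕ → ℕ) (n : ℕ) : ℕ → ℕ := fun m => a (2 ^ n * (2 * m + 1))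

/-- `f` codes the real number `r` with integer part `f 0 - f 1` and binary digits `f 2, f 3, …`.
Every real number has such a code. -/
def CodesReal (f : ℕ → ℕ) (r : ℝ) : Prop :=
  (∀ m, f (m + 2) ≤ 1) ∧
    HasSum (fun m : ℕ => (f (m + 2) : ℝ) / 2 ^ (m + 1)) (r - ((f 0 : ℝ) - (f 1 : ℝ)))

/-- Left endpoint of the interval `I_n`. With `n = ⟨⟨a, b⟩, ⟨d, e⟩⟩` it is `(a - b) / (d + 1)`. -/
noncomputable def leftEnd (n : ℕ) : ℝ :=
  ((n.unpair.1.unpair.1 : ℝ) - (n.unpair.1.unpair.2 : ℝ)) / ((n.unpair.2.unpair.1 : ℝ) + 1)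

/-- Right endpoint of the interval `I_n`. With `n = ⟨⟨a, b⟩, ⟨d, e⟩⟩` it is
`(a - b) / (d + 1) + (e + 1) / (d + 1)`. -/
noncomputable def rightEnd (n : ℕ) : ℝ :=
  leftEnd n + ((n.unpair.2.unpair.2 : ℝ) + 1) / ((n.unpair.2.unpair.1 : ℝ) + 1)

/-- An explicit enumeration `I_n` of the nonempty bounded open intervals with rational ends. -/
def ratInterval (n : ℕ) : Set ℝ := Set.Ioo (leftEnd n) (rightEnd n)

/-- The open set `G(a) = ⋃ {I_n : n ∈ a}` coded by `a`, where `n ∈ a` means `a n = 1`. -/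
def openOfCode (a : ℕ → ℕ) : Set ℝ := ⋃ n ∈ {n : ℕ | a n = 1}, ratInterval n

/-- The `G_δ` set `H(a) = ⋂ₙ G(a_n)` coded by `a`. -/
def gdeltaOfCode (a : ℕ → ℕ) : Set ℝ := ⋂ n : ℕ, openOfCode (proj a n)

/-- The family `𝒢_α` of the open sets of reals that contain `ℚ` and have a code in `L_α`. -/
def codedOpenSupersets (α : Ordinal.{u}) : Set (Set ℝ) :=
  {G | IsOpen G ∧ Set.range ((↑) : ℚ → ℝ) ⊆ G ∧ ∃ a : ℕ → ℕ, InLevel α a ∧ openOfCode a = G}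

open FirstOrder Filter Topology

/-!
The theorem is an effective form of the Baire category theorem. The sets `G(x_n) - y_m` are dense
and open, so there are nested rational intervals `I_{e_0} ⊇ I_{e_1} ⊇ ⋯` such that each condition
`y_m + c ∈ G(x_n)` holds for all `c` in one of them, and `c` is taken to be a common point. Since
`ℕ^ℕ ∩ L_α` is nonempty, `L_α` contains every finite set of pairs of natural numbers, so recursion
on `ℕ`, and hence arithmetic, is definable over `⟨L_α, ∈⟩`. The codes `x` and `y` are
parameters, and if every `e_{k+1}` is the least possible index, then the sequence of intervals is
definable over `L_α`. So are the binary digits of its limit `c`, which therefore has a code already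
in `L_{α+1}`.
-/

section Definability

/-- A representation of the elements of `α` in the `L`-structure `M`: every element is coded
injectively by a finite tuple of elements of `M`, and the tuples that are codes form a set which is
definable with parameters. It allows definability over `M` to be discussed for predicates on, and
functions between, types of objects coded in `M`. -/
class Represented (L : Language) (M : Type*) [L.Structure M] (α : Type*) where
  Index : Type
  finite_index : Finite Index
  rep : α → Index → M
  rep_injective : Function.Injective rep
  definable_range : (Set.univ : Set M).Definable L (Set.range rep)

namespace Represented

attribute [instance] finite_index

variable (L : Language) (M : Type*) [L.Structure M] {α β : Type*}

instance self : Represented L M M where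
  Index := Fin 1
  finite_index := inferInstance
  rep a _ := a
  rep_injective _ _ h := congrFun h 0
  definable_range := by
    convert Set.definable_univ
    exact Set.eq_univ_of_forall fun v => ⟨v 0, funext fun i => congrArg v (Subsingleton.elim 0 i)⟩

instance prod [Represented L M α] [Represented L M β] : Represented L M (α × β) where
  Index := Index L M α ⊕ Index L M β
  finite_index := inferInstance
  rep p := Sum.elim (rep p.1) (rep p.2)
  rep_injective p q h := by
    obtain ⟨h₁, h₂⟩ := Sum.elim_eq_iff.1 h
    exact Prod.ext (rep_injective h₁) (rep_injective h₂)
  definable_range := by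
    convert ((definable_range (L := L) (M := M) (α := α)).preimage_comp Sum.inl).inter
      ((definable_range (L := L) (M := M) (α := β)).preimage_comp Sum.inr) using 1
    ext v
    constructor
    · rintro ⟨p, rfl⟩
      exact ⟨⟨p.1, rfl⟩, p.2, rfl⟩
    · rintro ⟨⟨a, ha⟩, b, hb⟩
      exact ⟨(a, b), (congrArg₂ Sum.elim ha hb).trans (Sum.elim_comp_inl_inr v)⟩

end Represented

open Represented (rep rep_injective definable_range Index)

variable (L : Language) (M : Type*) [L.Structure M] {α β γ δ : Type*}
  [Represented L M α] [Represented L M β] [Represented L M γ] [Represented L M δ]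

/-- Definability over `M`, with parameters, of a predicate on a represented type. -/
def DefinablePred (P : α → Prop) : Prop :=
  (Set.univ : Set M).Definable L (rep (L := L) '' {a | P a})

/-- Definability over `M`, with parameters, of the graph of a function between represented types. -/
@[fun_prop]
def DefinableFun (f : α → β) : Prop :=
  DefinablePred L M fun p : α × β => f p.1 = p.2

/-- The code of `f a` is obtained from the code of `a` by selecting and rearranging entries. Such
functions are the projections, the pairing functions and their combinations. -/
def IsReindexing (f : α → β) : Prop :=
  ∃ σ : Index L M β → Index L M α, ∀ a, (rep (f a) : Index L M β → M) = rep a ∘ σ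

variable {L M}

theorem IsReindexing.id : IsReindexing L M (fun a : α => a) :=
  ⟨_root_.id, fun _ => rfl⟩

theorem IsReindexing.fst {f : α → β × γ} (hf : IsReindexing L M f) :
    IsReindexing L M fun a => (f a).1 := by
  obtain ⟨σ, hσ⟩ := hf
  exact ⟨σ ∘ Sum.inl, fun a => congrArg (· ∘ Sum.inl) (hσ a)⟩

theorem IsReindexing.snd {f : α → β × γ} (hf : IsReindexing L M f) :
    IsReindexing L M fun a => (f a).2 := by
  obtain ⟨σ, hσ⟩ := hf
  exact ⟨σ ∘ Sum.inr, fun a => congrArg (· ∘ Sum.inr) (hσ a)⟩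

theorem IsReindexing.prodMk {f : α → β} {g : α → γ} (hf : IsReindexing L M f)
    (hg : IsReindexing L M g) : IsReindexing L M fun a => (f a, g a) := by
  obtain ⟨σ, hσ⟩ := hf
  obtain ⟨τ, hτ⟩ := hg
  refine ⟨Sum.elim σ τ, fun a => ?_⟩
  rw [Sum.comp_elim, ← hσ, ← hτ]
  rfl

theorem DefinablePred.congr {P Q : α → Prop} (hP : DefinablePred L M P) (h : ∀ a, P a ↔ Q a) :
    DefinablePred L M Q := by
  rwa [← funext fun a => propext (h a)]

theorem DefinablePred.and {P Q : α → Prop} (hP : DefinablePred L M P) (hQ : DefinablePred L M Q) :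
    DefinablePred L M fun a => P a ∧ Q a := by
  rw [DefinablePred, Set.ofPred_and, Set.image_inter rep_injective]
  exact hP.inter hQ

theorem DefinablePred.not {P : α → Prop} (hP : DefinablePred L M P) :
    DefinablePred L M fun a => ¬P a := by
  have h : rep (L := L) (M := M) '' {a | ¬P a} = Set.range rep \ rep '' {a | P a} := by
    rw [← Set.image_univ, ← Set.image_sdiff rep_injective, ← Set.compl_eq_univ_sdiff]
    rfl
  rw [DefinablePred, h]
  exact definable_range.sdiff hP

theorem DefinablePred.or {P Q : α → Prop} (hP : DefinablePred L M P) (hQ : DefinablePred L M Q) :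
    DefinablePred L M fun a => P a ∨ Q a :=
  (hP.not.and hQ.not).not.congr fun _ => by tauto

theorem DefinablePred.imp {P Q : α → Prop} (hP : DefinablePred L M P) (hQ : DefinablePred L M Q) :
    DefinablePred L M fun a => P a → Q a :=
  (hP.and hQ.not).not.congr fun _ => by tauto

theorem DefinablePred.iff {P Q : α → Prop} (hP : DefinablePred L M P) (hQ : DefinablePred L M Q) :
    DefinablePred L M fun a => P a ↔ Q a :=
  ((hP.imp hQ).and (hQ.imp hP)).congr fun _ => iff_iff_implies_and_implies.symm

theorem DefinablePred.exists {P : α × β → Prop} (hP : DefinablePred L M P) :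
    DefinablePred L M fun a => ∃ b, P (a, b) := by
  have h : rep (L := L) (M := M) '' {a | ∃ b, P (a, b)} =
      (fun v : Index L M (α × β) → M => v ∘ Sum.inl) '' (rep '' {p : α × β | P p}) := by
    ext v
    constructor
    · rintro ⟨a, ⟨b, h⟩, rfl⟩
      exact ⟨_, ⟨(a, b), h, rfl⟩, rfl⟩
    · rintro ⟨_, ⟨⟨a, b⟩, h, rfl⟩, rfl⟩
      exact ⟨a, ⟨b, h⟩, rfl⟩
  rw [DefinablePred, h]
  exact hP.image_comp Sum.inl

theorem DefinablePred.forall {P : α × β → Prop} (hP : DefinablePred L M P) :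
    DefinablePred L M fun a => ∀ b, P (a, b) :=
  hP.not.exists.not.congr fun _ => not_exists_not

theorem DefinablePred.comp_reindexing {P : β → Prop} {f : α → β} (hP : DefinablePred L M P)
    (hf : IsReindexing L M f) : DefinablePred L M fun a => P (f a) := by
  obtain ⟨σ, hσ⟩ := hf
  have h : rep (L := L) (M := M) '' {a | P (f a)} =
      Set.range rep ∩ (fun v => v ∘ σ) ⁻¹' (rep '' {b | P b}) := by
    ext v
    constructor
    · rintro ⟨a, ha, rfl⟩
      exact ⟨⟨a, rfl⟩, f a, ha, hσ a⟩
    · rintro ⟨⟨a, rfl⟩, b, hb, hab⟩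
      refine ⟨a, ?_, rfl⟩
      rwa [rep_injective (hab.trans (hσ a).symm)] at hb
  rw [DefinablePred, h]
  exact definable_range.inter (hP.preimage_comp σ)

theorem DefinablePred.comp {P : β → Prop} {f : α → β} (hP : DefinablePred L M P)
    (hf : DefinableFun L M f) : DefinablePred L M fun a => P (f a) :=
  (hf.and (hP.comp_reindexing IsReindexing.id.snd)).exists.congr fun _ => by
    simp only [exists_eq_left']

theorem DefinablePred.eq {f g : α → β} (hf : DefinableFun L M f) (hg : DefinableFun L M g) :
    DefinablePred L M fun a => f a = g a :=
  (hg.and hf).exists.congr fun _ => by simp only [exists_eq_left']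

theorem DefinableFun.of_reindexing {f : α → β} (hf : IsReindexing L M f) :
    DefinableFun L M f := by
  obtain ⟨σ, hσ⟩ := hf
  have hdiag : (Set.univ : Set M).Definable L
      (⋂ j, {v : Index L M (α × β) → M | v (Sum.inl (σ j)) = v (Sum.inr j)}) :=
    Set.definable_iInter_of_finite fun j =>
      Set.Definable.preimage_comp ![Sum.inl (σ j), Sum.inr j] (Set.Definable.diagonal L _)
  have h : rep (L := L) (M := M) '' {p : α × β | f p.1 = p.2} =
      Set.range rep ∩ ⋂ j, {v | v (Sum.inl (σ j)) = v (Sum.inr j)} := by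
    ext v
    constructor
    · rintro ⟨⟨a, b⟩, rfl : f a = b, rfl⟩
      exact ⟨⟨_, rfl⟩, Set.mem_iInter.2 fun j => (congrFun (hσ a) j).symm⟩
    · rintro ⟨⟨⟨a, b⟩, rfl⟩, hab⟩
      exact ⟨(a, b), rep_injective ((hσ a).trans (funext (Set.mem_iInter.1 hab))), rfl⟩
  rw [DefinableFun, DefinablePred, h]
  exact definable_range.inter hdiag

theorem DefinableFun.const (b : β) : DefinableFun L M fun _ : α => b := by
  have hb : (Set.univ : Set M).Definable L
      (⋂ j, {v : Index L M (α × β) → M | v (Sum.inr j) = rep b j}) :=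
    Set.definable_iInter_of_finite fun j => Set.Definable.preimage_comp (fun _ => Sum.inr j)
      (Set.Definable.singleton_of_mem L (Set.mem_univ (rep b j)))
  have h : rep (L := L) (M := M) '' {p : α × β | b = p.2} =
      Set.range rep ∩ ⋂ j, {v | v (Sum.inr j) = rep b j} := by
    ext v
    constructor
    · rintro ⟨⟨a, _⟩, rfl : b = _, rfl⟩
      exact ⟨⟨_, rfl⟩, Set.mem_iInter.2 fun j => rfl⟩
    · rintro ⟨⟨⟨a, b'⟩, rfl⟩, h⟩
      exact ⟨(a, b'), (rep_injective (funext (Set.mem_iInter.1 h))).symm, rfl⟩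
  rw [DefinableFun, DefinablePred, h]
  exact definable_range.inter hb

theorem DefinableFun.id : DefinableFun L M (fun a : α => a) := of_reindexing .id

theorem DefinableFun.comp {g : β → γ} {f : α → β} (hg : DefinableFun L M g)
    (hf : DefinableFun L M f) : DefinableFun L M fun a => g (f a) :=
  ((hf.comp_reindexing (.prodMk IsReindexing.id.fst.fst IsReindexing.id.snd)).and
    (hg.comp_reindexing (.prodMk IsReindexing.id.snd IsReindexing.id.fst.snd))).exists.congr
      fun _ => by simp only [exists_eq_left']

theorem DefinableFun.fst {f : α → β × γ} (hf : DefinableFun L M f) :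
    DefinableFun L M fun a => (f a).1 :=
  (of_reindexing IsReindexing.id.fst).comp hf

theorem DefinableFun.snd {f : α → β × γ} (hf : DefinableFun L M f) :
    DefinableFun L M fun a => (f a).2 :=
  (of_reindexing IsReindexing.id.snd).comp hf

theorem DefinableFun.prodMk {f : α → β} {g : α → γ} (hf : DefinableFun L M f)
    (hg : DefinableFun L M g) : DefinableFun L M fun a => (f a, g a) :=
  ((hf.comp_reindexing (.prodMk IsReindexing.id.fst IsReindexing.id.snd.fst)).and
    (hg.comp_reindexing (.prodMk IsReindexing.id.fst IsReindexing.id.snd.snd))).congr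
      fun _ => Prod.mk_inj.symm

attribute [fun_prop] DefinableFun.id DefinableFun.const DefinableFun.comp DefinableFun.fst
  DefinableFun.snd DefinableFun.prodMk

end Definability

section Arithmetic

/-- A representation of `ℕ` in `M` with a definable successor function, such that every finite set
of pairs of natural numbers is `{(i, a) | R c i a}` for some `c : M`, where the relation `R` is
definable. Quantifying over such `c` makes functions given by recursion definable. -/
class NatCoding (L : Language) (M : Type*) [L.Structure M] [Represented L M ℕ] : Prop where
  succ : DefinableFun L M Nat.succ
  exists_finset_coding : ∃ R : M → ℕ → ℕ → Prop,
    DefinablePred L M (fun p : M × ℕ × ℕ => R p.1 p.2.1 p.2.2) ∧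
      ∀ F : Finset (ℕ × ℕ), ∃ c, ∀ i a, R c i a ↔ (i, a) ∈ F

variable {L : Language} {M : Type*} [L.Structure M] [Represented L M ℕ] [NatCoding L M]
  {α : Type*} [Represented L M α]

theorem natRec_eq_iff {M : Type*} {R : M → ℕ → ℕ → Prop}
    (hR : ∀ F : Finset (ℕ × ℕ), ∃ c, ∀ i a, R c i a ↔ (i, a) ∈ F) (a : ℕ) (g : ℕ → ℕ → ℕ)
    (n m : ℕ) : n.rec a g = m ↔
      ∀ c, R c 0 a ∧ (∀ i z, R c i z → i = n ∨ R c (i + 1) (g i z)) → R c n m := by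
  constructor
  · rintro rfl c ⟨h_zero, h_succ⟩
    have h : ∀ i ≤ n, R c i (i.rec a g) := by
      intro i
      induction i with
      | zero => exact fun _ => h_zero
      | succ i ih => exact fun hi => (h_succ i _ (ih (by lia))).resolve_left (by lia)
    exact h n le_rfl
  · intro h
    obtain ⟨c, hc⟩ := hR ((Finset.range (n + 1)).image fun i => (i, i.rec a g))
    simp only [Finset.mem_image, Finset.mem_range, Prod.mk.injEq] at hc
    have := h c ⟨(hc _ _).2 ⟨0, by lia, rfl, rfl⟩, fun i z hz => ?_⟩
    · obtain ⟨_, -, rfl, rfl⟩ := (hc _ _).1 this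
      rfl
    · obtain ⟨i, hi, rfl, rfl⟩ := (hc _ _).1 hz
      exact or_iff_not_imp_left.2 fun hin => (hc _ _).2 ⟨i + 1, by lia, rfl, rfl⟩

@[fun_prop]
theorem DefinableFun.succ {f : α → ℕ} (hf : DefinableFun L M f) :
    DefinableFun L M fun a => f a + 1 :=
  NatCoding.succ.comp hf

@[fun_prop]
theorem DefinableFun.natRec {f n : α → ℕ} {g : α → ℕ → ℕ → ℕ} (hf : DefinableFun L M f)
    (hg : DefinableFun L M fun p : α × ℕ × ℕ => g p.1 p.2.1 p.2.2) (hn : DefinableFun L M n) :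
    DefinableFun L M fun a => (n a).rec (motive := fun _ => ℕ) (f a) (g a) := by
  obtain ⟨R, hR, hcode⟩ := NatCoding.exists_finset_coding (L := L) (M := M)
  have h_zero : DefinablePred L M fun p : (α × ℕ) × M => R p.2 0 (f p.1.1) :=
    hR.comp (f := fun p : (α × ℕ) × M => (p.2, 0, f p.1.1)) (by fun_prop)
  have h_mem : DefinablePred L M fun p : (((α × ℕ) × M) × ℕ) × ℕ => R p.1.1.2 p.1.2 p.2 :=
    hR.comp (f := fun p : (((α × ℕ) × M) × ℕ) × ℕ => (p.1.1.2, p.1.2, p.2)) (by fun_prop)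
  have h_stop : DefinablePred L M fun p : (((α × ℕ) × M) × ℕ) × ℕ => p.1.2 = n p.1.1.1.1 :=
    .eq (by fun_prop) (by fun_prop)
  have h_succ : DefinablePred L M fun p : (((α × ℕ) × M) × ℕ) × ℕ =>
      R p.1.1.2 (p.1.2 + 1) (g p.1.1.1.1 p.1.2 p.2) :=
    hR.comp (f := fun p : (((α × ℕ) × M) × ℕ) × ℕ =>
      (p.1.1.2, p.1.2 + 1, g p.1.1.1.1 p.1.2 p.2)) (by fun_prop)
  have h_last : DefinablePred L M fun p : (α × ℕ) × M => R p.2 (n p.1.1) p.1.2 :=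
    hR.comp (f := fun p : (α × ℕ) × M => (p.2, n p.1.1, p.1.2)) (by fun_prop)
  exact ((h_zero.and (h_mem.imp (h_stop.or h_succ)).forall.forall).imp h_last).forall.congr
    fun p => (natRec_eq_iff hcode (f p.1) (g p.1) (n p.1) p.2).symm

@[fun_prop]
theorem DefinableFun.add {f g : α → ℕ} (hf : DefinableFun L M f) (hg : DefinableFun L M g) :
    DefinableFun L M fun a => f a + g a := by
  have h : DefinableFun L M fun a => (g a).rec (motive := fun _ => ℕ) (f a) fun _ z => z + 1 := by
    fun_prop
  convert h using 2 with a
  induction g a with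
  | zero => rfl
  | succ n ih => rw [← add_assoc, ih]

@[fun_prop]
theorem DefinableFun.mul {f g : α → ℕ} (hf : DefinableFun L M f) (hg : DefinableFun L M g) :
    DefinableFun L M fun a => f a * g a := by
  have h : DefinableFun L M fun a => (g a).rec (motive := fun _ => ℕ) 0 fun _ z => z + f a := by
    fun_prop
  convert h using 2 with a
  induction g a with
  | zero => rfl
  | succ n ih => rw [Nat.mul_succ, ih]

@[fun_prop]
theorem DefinableFun.pow {f g : α → ℕ} (hf : DefinableFun L M f) (hg : DefinableFun L M g) :
    DefinableFun L M fun a => f a ^ g a := by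
  have h : DefinableFun L M fun a => (g a).rec (motive := fun _ => ℕ) 1 fun _ z => z * f a := by
    fun_prop
  convert h using 2 with a
  induction g a with
  | zero => rfl
  | succ n ih => rw [pow_succ, ih]

theorem DefinablePred.le {f g : α → ℕ} (hf : DefinableFun L M f) (hg : DefinableFun L M g) :
    DefinablePred L M fun a => f a ≤ g a := by
  have h : DefinablePred L M fun p : α × ℕ => g p.1 = f p.1 + p.2 :=
    .eq (by fun_prop) (by fun_prop)
  exact h.exists.congr fun a => by rw [le_iff_exists_add]

theorem DefinablePred.lt {f g : α → ℕ} (hf : DefinableFun L M f) (hg : DefinableFun L M g) :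
    DefinablePred L M fun a => f a < g a :=
  .le hf.succ hg

theorem DefinableFun.unpair {f : α → ℕ} (hf : DefinableFun L M f) :
    DefinableFun L M fun a => (f a).unpair := by
  have h : DefinablePred L M fun p : α × ℕ × ℕ =>
      p.2.1 < p.2.2 ∧ f p.1 = p.2.2 * p.2.2 + p.2.1 ∨
        ¬p.2.1 < p.2.2 ∧ f p.1 = p.2.1 * p.2.1 + p.2.1 + p.2.2 :=
    .or (.and (.lt (by fun_prop) (by fun_prop)) (.eq (by fun_prop) (by fun_prop)))
      (.and (.not (.lt (by fun_prop) (by fun_prop))) (.eq (by fun_prop) (by fun_prop)))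
  refine h.congr fun ⟨a, b⟩ => ?_
  rw [← Nat.pairEquiv_symm_apply, Equiv.symm_apply_eq, Nat.pairEquiv_apply, Function.uncurry,
    Nat.pair]
  split_ifs with hb <;> simp [hb]

@[fun_prop]
theorem DefinableFun.unpair_fst {f : α → ℕ} (hf : DefinableFun L M f) :
    DefinableFun L M fun a => (f a).unpair.1 :=
  hf.unpair.fst

@[fun_prop]
theorem DefinableFun.unpair_snd {f : α → ℕ} (hf : DefinableFun L M f) :
    DefinableFun L M fun a => (f a).unpair.2 :=
  hf.unpair.snd

@[fun_prop]
theorem DefinableFun.mod {f g : α → ℕ} (hf : DefinableFun L M f) (hg : DefinableFun L M g) :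
    DefinableFun L M fun a => f a % g a := by
  have h : DefinablePred L M fun p : α × ℕ =>
      (g p.1 = 0 ∨ p.2 < g p.1) ∧ ∃ q, g p.1 * q + p.2 = f p.1 :=
    .and (.or (.eq (by fun_prop) (by fun_prop)) (.lt (by fun_prop) (by fun_prop)))
      (.exists (P := fun q : (α × ℕ) × ℕ => g q.1.1 * q.2 + q.1.2 = f q.1.1)
        (.eq (by fun_prop) (by fun_prop)))
  refine h.congr fun ⟨a, r⟩ => ⟨fun ⟨hr, q, hq⟩ => ?_, fun hr => ?_⟩
  · dsimp only at hr hq ⊢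
    rw [← hq, Nat.mul_add_mod]
    rcases hr with hg | hr
    exacts [by rw [hg, Nat.mod_zero], Nat.mod_eq_of_lt hr]
  · obtain rfl : f a % g a = r := hr
    exact ⟨(g a).eq_zero_or_pos.imp_right (Nat.mod_lt _), f a / g a, Nat.div_add_mod _ _⟩

theorem DefinableFun.nat_sInf {P : α × ℕ → Prop} (hP : DefinablePred L M P)
    (h : ∀ a, ∃ n, P (a, n)) : DefinableFun L M fun a => sInf {n | P (a, n)} := by
  have h_min : DefinablePred L M fun p : α × ℕ => P p ∧ ∀ k, P (p.1, k) → p.2 ≤ k :=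
    hP.and (.forall (P := fun q : (α × ℕ) × ℕ => P (q.1.1, q.2) → q.1.2 ≤ q.2)
      (.imp (hP.comp (by fun_prop)) (.le (by fun_prop) (by fun_prop))))
  refine h_min.congr fun ⟨a, m⟩ => ⟨fun ⟨hm, hle⟩ => ?_, fun hm => ?_⟩
  · exact (Nat.sInf_le hm).antisymm (hle _ (Nat.sInf_mem (h a)))
  · obtain rfl : sInf {n | P (a, n)} = m := hm
    exact ⟨Nat.sInf_mem (h a), fun k hk => Nat.sInf_le hk⟩

end Arithmetic

section RealNumbers

variable (L : Language) (M : Type*) [L.Structure M] [Represented L M ℕ]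
  {α β : Type*} [Represented L M α] [Represented L M β]

/-- A function into `ℝ` that takes rational values and is definable over `M`, in the sense that its
values are fractions whose numerators, written as differences of natural numbers, and denominators
are definable. -/
def DefinableRat (f : α → ℝ) : Prop :=
  ∃ p q r : α → ℕ, DefinableFun L M p ∧ DefinableFun L M q ∧ DefinableFun L M r ∧
    ∀ a, 0 < r a ∧ f a = ((p a : ℝ) - q a) / r a

/-- A real-valued function that is a pointwise limit of a sequence, definable over `M`, of functions
with rational values. No rate of convergence is required. -/
def DefinableReal (f : α → ℝ) : Prop :=
  ∃ q : α × ℕ → ℝ, DefinableRat L M q ∧ ∀ a, Tendsto (fun n => q (a, n)) atTop (𝓝 (f a))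

variable {L M}

theorem DefinableRat.comp {f : β → ℝ} {g : α → β} (hf : DefinableRat L M f)
    (hg : DefinableFun L M g) : DefinableRat L M fun a => f (g a) := by
  obtain ⟨p, q, r, hp, hq, hr, h⟩ := hf
  exact ⟨_, _, _, hp.comp hg, hq.comp hg, hr.comp hg, fun a => h (g a)⟩

theorem DefinableReal.comp {f : β → ℝ} {g : α → β} (hf : DefinableReal L M f)
    (hg : DefinableFun L M g) : DefinableReal L M fun a => f (g a) := by
  obtain ⟨q, hq, h⟩ := hf
  exact ⟨fun p => q (g p.1, p.2), hq.comp (by fun_prop), fun a => h (g a)⟩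

theorem DefinableRat.definableReal {f : α → ℝ} (hf : DefinableRat L M f) :
    DefinableReal L M f :=
  ⟨fun p => f p.1, hf.comp (by fun_prop), fun _ => tendsto_const_nhds⟩

theorem DefinableRat.natCast {n : α → ℕ} (hn : DefinableFun L M n) :
    DefinableRat L M fun a => (n a : ℝ) :=
  ⟨n, fun _ => 0, fun _ => 1, hn, .const 0, .const 1, fun _ => ⟨one_pos, by simp⟩⟩

variable [NatCoding L M]

theorem DefinableRat.div_natCast {f : α → ℝ} {n : α → ℕ} (hf : DefinableRat L M f)
    (hn : DefinableFun L M n) (h_pos : ∀ a, 0 < n a) : DefinableRat L M fun a => f a / n a := by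
  obtain ⟨p, q, r, hp, hq, hr, h⟩ := hf
  exact ⟨p, q, fun a => r a * n a, hp, hq, by fun_prop, fun a =>
    ⟨mul_pos (h a).1 (h_pos a), by beta_reduce; rw [(h a).2, div_div, Nat.cast_mul]⟩⟩

theorem DefinableRat.sub {f g : α → ℝ} (hf : DefinableRat L M f) (hg : DefinableRat L M g) :
    DefinableRat L M fun a => f a - g a := by
  obtain ⟨p, q, r, hp, hq, hr, h⟩ := hf
  obtain ⟨p', q', r', hp', hq', hr', h'⟩ := hg
  refine ⟨fun a => p a * r' a + q' a * r a, fun a => q a * r' a + p' a * r a, fun a => r a * r' a,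
    by fun_prop, by fun_prop, by fun_prop, fun a => ⟨mul_pos (h a).1 (h' a).1, ?_⟩⟩
  have hr := Nat.cast_pos (α := ℝ).2 (h a).1
  have hr' := Nat.cast_pos (α := ℝ).2 (h' a).1
  beta_reduce
  rw [(h a).2, (h' a).2, div_sub_div _ _ hr.ne' hr'.ne']
  push_cast
  ring

theorem DefinableRat.add {f g : α → ℝ} (hf : DefinableRat L M f) (hg : DefinableRat L M g) :
    DefinableRat L M fun a => f a + g a := by
  have h_zero : DefinableRat L M fun _ : α => ((0 : ℕ) : ℝ) := .natCast (.const 0)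
  simpa using hf.sub (h_zero.sub hg)

theorem DefinableRat.mul {f g : α → ℝ} (hf : DefinableRat L M f) (hg : DefinableRat L M g) :
    DefinableRat L M fun a => f a * g a := by
  obtain ⟨p, q, r, hp, hq, hr, h⟩ := hf
  obtain ⟨p', q', r', hp', hq', hr', h'⟩ := hg
  refine ⟨fun a => p a * p' a + q a * q' a, fun a => p a * q' a + q a * p' a, fun a => r a * r' a,
    by fun_prop, by fun_prop, by fun_prop, fun a => ⟨mul_pos (h a).1 (h' a).1, ?_⟩⟩
  beta_reduce
  rw [(h a).2, (h' a).2, div_mul_div_comm]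
  push_cast
  ring

theorem DefinableRat.le {f g : α → ℝ} (hf : DefinableRat L M f) (hg : DefinableRat L M g) :
    DefinablePred L M fun a => f a ≤ g a := by
  obtain ⟨p, q, r, hp, hq, -, h⟩ := hg.sub hf
  refine (DefinablePred.le hq hp).congr fun a => ?_
  have := (h a).2
  beta_reduce at this
  rw [← sub_nonneg (a := g a), this, le_div_iff₀ (Nat.cast_pos.2 (h a).1), zero_mul, sub_nonneg,
    Nat.cast_le]

theorem DefinableRat.lt {f g : α → ℝ} (hf : DefinableRat L M f) (hg : DefinableRat L M g) :
    DefinablePred L M fun a => f a < g a :=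
  (hg.le hf).not.congr fun _ => not_le

theorem DefinableReal.add {f g : α → ℝ} (hf : DefinableReal L M f) (hg : DefinableReal L M g) :
    DefinableReal L M fun a => f a + g a := by
  obtain ⟨u, hu, hfu⟩ := hf
  obtain ⟨v, hv, hgv⟩ := hg
  exact ⟨fun p => u p + v p, hu.add hv, fun a => (hfu a).add (hgv a)⟩

theorem DefinableReal.mul {f g : α → ℝ} (hf : DefinableReal L M f) (hg : DefinableReal L M g) :
    DefinableReal L M fun a => f a * g a := by
  obtain ⟨u, hu, hfu⟩ := hf
  obtain ⟨v, hv, hgv⟩ := hg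
  exact ⟨fun p => u p * v p, hu.mul hv, fun a => (hfu a).mul (hgv a)⟩

theorem le_iff_eventually_le_add_of_tendsto {u v : ℕ → ℝ} {x y : ℝ} (hu : Tendsto u atTop (𝓝 x))
    (hv : Tendsto v atTop (𝓝 y)) :
    x ≤ y ↔ ∀ k : ℕ, ∃ n₀, ∀ n, n₀ ≤ n → u n ≤ v n + 1 / (k + 1 : ℕ) := by
  simp only [← eventually_atTop]
  constructor
  · intro hxy k
    have : x < y + 1 / (k + 1 : ℕ) := lt_add_of_le_of_pos hxy (by positivity)
    filter_upwards [hu.eventually_lt (hv.add_const _) this] with n hn using hn.le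
  · intro h
    refine le_of_forall_pos_le_add fun ε hε => ?_
    obtain ⟨k, hk⟩ := exists_nat_one_div_lt hε
    refine (le_of_tendsto_of_tendsto hu (hv.add_const _) (h k)).trans ?_
    push_cast
    gcongr

theorem DefinableReal.le {f g : α → ℝ} (hf : DefinableReal L M f) (hg : DefinableReal L M g) :
    DefinablePred L M fun a => f a ≤ g a := by
  obtain ⟨u, hu, hfu⟩ := hf
  obtain ⟨v, hv, hgv⟩ := hg
  have h : DefinablePred L M fun p : ((α × ℕ) × ℕ) × ℕ =>
      p.1.2 ≤ p.2 → u (p.1.1.1, p.2) ≤ v (p.1.1.1, p.2) + (1 : ℕ) / (p.1.1.2 + 1 : ℕ) :=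
    (DefinablePred.le (by fun_prop) (by fun_prop)).imp
      ((hu.comp (by fun_prop)).le ((hv.comp (by fun_prop)).add
        (DefinableRat.div_natCast (.natCast (.const 1)) (by fun_prop) fun _ => Nat.succ_pos _)))
  refine h.forall.exists.forall.congr fun a => ?_
  rw [le_iff_eventually_le_add_of_tendsto (hfu a) (hgv a), Nat.cast_one]

theorem DefinableReal.natFloor {f : α → ℝ} (hf : DefinableReal L M f) :
    DefinableFun L M fun a => ⌊f a⌋₊ := by
  have hf' : DefinableReal L M fun p : α × ℕ => f p.1 := hf.comp (by fun_prop)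
  have h_le : DefinablePred L M fun p : α × ℕ => (p.2 = 0 ∨ (p.2 : ℝ) ≤ f p.1) ∧
      ¬((p.2 + 1 : ℕ) : ℝ) ≤ f p.1 :=
    .and (.or (.eq (by fun_prop) (by fun_prop))
      ((DefinableRat.natCast (by fun_prop)).definableReal.le hf'))
      ((DefinableRat.natCast (by fun_prop)).definableReal.le hf').not
  refine h_le.congr fun ⟨a, n⟩ => ?_
  have h_floor : (n = 0 ∨ (n : ℝ) ≤ f a) ↔ n ≤ ⌊f a⌋₊ := by
    rcases eq_or_ne n 0 with rfl | hn
    · simp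
    · simp only [hn, false_or, Nat.le_floor_iff' hn]
  rw [h_floor, ← Nat.le_floor_iff' n.succ_ne_zero]
  lia

end RealNumbers

section TransitiveSets

variable {A : ZFSet.{u}} {α : Type*} [Represented LST {z // z ∈ A} α]

theorem DefinablePred.mem {f g : α → {z // z ∈ A}} (hf : DefinableFun LST {z // z ∈ A} f)
    (hg : DefinableFun LST {z // z ∈ A} g) :
    DefinablePred LST {z // z ∈ A} fun a => (f a).1 ∈ (g a).1 := by
  have h_mem : DefinablePred LST {z // z ∈ A}
      fun p : {z // z ∈ A} × {z // z ∈ A} => p.1.1 ∈ p.2.1 := by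
    refine Set.Definable.mono (Set.empty_definable_iff.2
      ⟨Language.Relations.formula₂ (L := LST) MemRel.mem (Language.var (Sum.inl (0 : Fin 1)))
        (Language.var (Sum.inr (0 : Fin 1))), ?_⟩) (Set.empty_subset _)
    ext v
    constructor
    · rintro ⟨p, hp, rfl⟩
      exact hp
    · exact fun hv => ⟨(v (Sum.inl (0 : Fin 1)), v (Sum.inr (0 : Fin 1))), hv,
        funext (Sum.forall.2 ⟨Fin.forall_fin_one.2 rfl, Fin.forall_fin_one.2 rfl⟩)⟩
  exact h_mem.comp (hf.prodMk hg)

theorem eq_iff_forall_mem_of_subset {A s t : ZFSet.{u}} (hs : s ⊆ A) (ht : t ⊆ A) :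
    s = t ↔ ∀ c : {z // z ∈ A}, c.1 ∈ s ↔ c.1 ∈ t :=
  ⟨fun h c => by rw [h], fun h => ZFSet.ext fun z =>
    ⟨fun hz => (h ⟨z, hs hz⟩).1 hz, fun hz => (h ⟨z, ht hz⟩).2 hz⟩⟩

theorem insert_subset_of_mem {A a s : ZFSet.{u}} (ha : a ∈ A) (hs : s ⊆ A) : insert a s ⊆ A := by
  intro z hz
  rcases ZFSet.mem_insert_iff.1 hz with rfl | hz
  exacts [ha, hs hz]

theorem DefinablePred.eq_insert_singleton (hA : A.IsTransitive) {f g h : α → {z // z ∈ A}}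
    (hf : DefinableFun LST {z // z ∈ A} f) (hg : DefinableFun LST {z // z ∈ A} g)
    (hh : DefinableFun LST {z // z ∈ A} h) :
    DefinablePred LST {z // z ∈ A} fun a => (h a).1 = {(f a).1, (g a).1} := by
  have h_ext : DefinablePred LST {z // z ∈ A} fun p : α × {z // z ∈ A} =>
      p.2.1 ∈ (h p.1).1 ↔ p.2 = f p.1 ∨ p.2 = g p.1 :=
    .iff (.mem (by fun_prop) (by fun_prop))
      (.or (.eq (by fun_prop) (by fun_prop)) (.eq (by fun_prop) (by fun_prop)))
  refine h_ext.forall.congr fun a => ?_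
  have h_subset : {(f a).1, (g a).1} ⊆ A := fun z hz => by
    rcases ZFSet.mem_pair.1 hz with rfl | rfl
    exacts [(f a).2, (g a).2]
  rw [eq_iff_forall_mem_of_subset (hA.subset_of_mem (h a).2) h_subset]
  simp only [ZFSet.mem_pair, Subtype.ext_iff]

theorem DefinablePred.eq_pair (hA : A.IsTransitive) {f g h : α → {z // z ∈ A}}
    (hf : DefinableFun LST {z // z ∈ A} f) (hg : DefinableFun LST {z // z ∈ A} g)
    (hh : DefinableFun LST {z // z ∈ A} h) :
    DefinablePred LST {z // z ∈ A} fun a => (h a).1 = ZFSet.pair (f a).1 (g a).1 := by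
  have h_kuratowski : DefinablePred LST {z // z ∈ A}
      fun p : (α × {z // z ∈ A}) × {z // z ∈ A} =>
        p.1.2.1 = {(f p.1.1).1, (f p.1.1).1} ∧ p.2.1 = {(f p.1.1).1, (g p.1.1).1} ∧
          (h p.1.1).1 = {p.1.2.1, p.2.1} :=
    .and (.eq_insert_singleton hA (by fun_prop) (by fun_prop) (by fun_prop))
      (.and (.eq_insert_singleton hA (by fun_prop) (by fun_prop) (by fun_prop))
        (.eq_insert_singleton hA (by fun_prop) (by fun_prop) (by fun_prop)))
  refine h_kuratowski.exists.exists.congr fun a => ⟨?_, fun heq => ?_⟩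
  · rintro ⟨c, d, hc, hd, heq⟩
    rw [heq, hc, hd, ZFSet.pair, ZFSet.pair_eq_singleton]
  · rw [ZFSet.pair] at heq
    refine ⟨⟨{(f a).1}, hA.subset_of_mem (h a).2 (by simp [heq])⟩,
      ⟨{(f a).1, (g a).1}, hA.subset_of_mem (h a).2 (by simp [heq])⟩, ?_, rfl, heq⟩
    exact (ZFSet.pair_eq_singleton _).symm

theorem DefinablePred.pair_mem (hA : A.IsTransitive) {f g h : α → {z // z ∈ A}}
    (hf : DefinableFun LST {z // z ∈ A} f) (hg : DefinableFun LST {z // z ∈ A} g)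
    (hh : DefinableFun LST {z // z ∈ A} h) :
    DefinablePred LST {z // z ∈ A} fun a => ZFSet.pair (f a).1 (g a).1 ∈ (h a).1 := by
  have h_witness : DefinablePred LST {z // z ∈ A} fun p : α × {z // z ∈ A} =>
      p.2.1 = ZFSet.pair (f p.1).1 (g p.1).1 ∧ p.2.1 ∈ (h p.1).1 :=
    .and (.eq_pair hA (by fun_prop) (by fun_prop) (by fun_prop)) (.mem (by fun_prop) (by fun_prop))
  refine h_witness.exists.congr fun a => ⟨?_, fun hmem => ?_⟩
  · rintro ⟨c, hc, hmem⟩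
    rwa [← hc]
  · exact ⟨⟨_, hA.subset_of_mem (h a).2 hmem⟩, rfl, hmem⟩

theorem mem_defPowerset_iff {s : ZFSet.{u}} :
    s ∈ defPowerset A ↔ s ⊆ A ∧ DefinablePred LST {z // z ∈ A} fun z : {z // z ∈ A} => z.1 ∈ s := by
  have h : {v : Fin 1 → {z // z ∈ A} | v 0 ∈ {z : {z // z ∈ A} | z.1 ∈ s}} =
      (fun z _ => z) '' {z : {z // z ∈ A} | z.1 ∈ s} := by
    ext v
    constructor
    · exact fun hv => ⟨v 0, hv, funext (Fin.forall_fin_one.2 rfl)⟩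
    · rintro ⟨z, hz, rfl⟩
      exact hz
  rw [defPowerset, ZFSet.mem_sep, ZFSet.mem_powerset, Set.Definable₁, h]
  rfl

theorem insert_mem_defPowerset (hA : A.IsTransitive) {a s : ZFSet.{u}} (ha : a ∈ A) (hs : s ∈ A) :
    insert a s ∈ defPowerset A := by
  have h : DefinablePred LST {z // z ∈ A} fun z : {z // z ∈ A} =>
      z = ⟨a, ha⟩ ∨ z.1 ∈ (⟨s, hs⟩ : {z // z ∈ A}).1 :=
    .or (.eq (by fun_prop) (by fun_prop)) (.mem (by fun_prop) (by fun_prop))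
  refine mem_defPowerset_iff.2 ⟨insert_subset_of_mem ha (hA.subset_of_mem hs), h.congr fun z => ?_⟩
  rw [ZFSet.mem_insert_iff, Subtype.ext_iff]

theorem subset_defPowerset (hA : A.IsTransitive) : A ⊆ defPowerset A := fun s hs =>
  mem_defPowerset_iff.2 ⟨hA.subset_of_mem hs,
    .mem (g := fun _ => ⟨s, hs⟩) (by fun_prop) (by fun_prop)⟩

end TransitiveSets

section ConstructibleHierarchy

theorem isTransitive_constructibleLevel (α : Ordinal.{u}) :
    (constructibleLevel α).IsTransitive := by
  induction α using Ordinal.limitRecOn with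
  | zero =>
    rw [constructibleLevel_zero]
    exact ZFSet.isTransitive_empty
  | add_one β ih =>
    rw [constructibleLevel_add_one]
    exact fun s hs => (mem_defPowerset_iff.1 hs).1.trans (subset_defPowerset ih)
  | limit β hβ ih =>
    rw [constructibleLevel_limit β hβ]
    exact ZFSet.IsTransitive.iUnion fun γ => ih γ.1 γ.2

theorem constructibleLevel_mono {α β : Ordinal.{u}} (h : α ≤ β) :
    constructibleLevel α ⊆ constructibleLevel β := by
  induction β using Ordinal.limitRecOn with
  | zero => rw [nonpos_iff_eq_zero.1 h]
  | add_one β ih =>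
    rcases h.eq_or_lt with rfl | h
    · rfl
    · rw [constructibleLevel_add_one]
      exact (ih (Order.lt_add_one_iff.1 h)).trans
        (subset_defPowerset (isTransitive_constructibleLevel β))
  | limit β hβ ih =>
    rcases h.eq_or_lt with rfl | h
    · rfl
    · rw [constructibleLevel_limit β hβ]
      exact ZFSet.subset_iUnion (fun γ : Set.Iio β => constructibleLevel γ.1) ⟨α, h⟩

theorem rank_lt_of_mem_constructibleLevel {α : Ordinal.{u}} {z : ZFSet.{u}}
    (hz : z ∈ constructibleLevel α) : z.rank < α := by
  induction α using Ordinal.limitRecOn generalizing z with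
  | zero => simp [constructibleLevel_zero] at hz
  | add_one β ih =>
    rw [constructibleLevel_add_one] at hz
    rw [Order.lt_add_one_iff, ZFSet.rank_le_iff]
    exact fun y hy => ih ((mem_defPowerset_iff.1 hz).1 hy)
  | limit β hβ ih =>
    rw [constructibleLevel_limit β hβ, ZFSet.mem_iUnion] at hz
    obtain ⟨γ, hγ⟩ := hz
    exact (ih γ.1 γ.2 hγ).trans γ.2

variable {β : Ordinal.{u}}

theorem insert_mem_constructibleLevel (hβ : Order.IsSuccLimit β) {a s : ZFSet.{u}}
    (ha : a ∈ constructibleLevel β) (hs : s ∈ constructibleLevel β) :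
    insert a s ∈ constructibleLevel β := by
  rw [constructibleLevel_limit β hβ, ZFSet.mem_iUnion] at ha hs
  obtain ⟨⟨γ, hγ⟩, ha⟩ := ha
  obtain ⟨⟨δ, hδ⟩, hs⟩ := hs
  refine constructibleLevel_mono (hβ.add_one_lt (max_lt hγ hδ)).le ?_
  rw [constructibleLevel_add_one]
  exact insert_mem_defPowerset (isTransitive_constructibleLevel _)
    (constructibleLevel_mono (le_max_left _ _) ha) (constructibleLevel_mono (le_max_right _ _) hs)

theorem empty_mem_constructibleLevel (hβ : 0 < β) : ∅ ∈ constructibleLevel β := by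
  refine constructibleLevel_mono (Order.add_one_le_of_lt hβ) ?_
  rw [constructibleLevel_add_one, mem_defPowerset_iff]
  refine ⟨ZFSet.empty_subset _, DefinablePred.congr (P := fun z => z ≠ z)
    (DefinablePred.eq .id .id).not fun z => ?_⟩
  simp only [ne_eq, not_true_eq_false, ZFSet.notMem_empty]

theorem pair_mem_constructibleLevel (hβ : Order.IsSuccLimit β) {a b : ZFSet.{u}}
    (ha : a ∈ constructibleLevel β) (hb : b ∈ constructibleLevel β) :
    ZFSet.pair a b ∈ constructibleLevel β := by
  have h_singleton {c : ZFSet.{u}} (hc : c ∈ constructibleLevel β) :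
      {c} ∈ constructibleLevel β := by
    rw [← LawfulSingleton.insert_empty_eq]
    exact insert_mem_constructibleLevel hβ hc (empty_mem_constructibleLevel hβ.bot_lt)
  exact insert_mem_constructibleLevel hβ (h_singleton ha)
    (h_singleton (insert_mem_constructibleLevel hβ ha (h_singleton hb)))

theorem toZFSet_natCast_mem_constructibleLevel (hβ : Order.IsSuccLimit β) (n : ℕ) :
    Ordinal.toZFSet (n : Ordinal.{u}) ∈ constructibleLevel β := by
  induction n with
  | zero => simpa using empty_mem_constructibleLevel hβ.bot_lt
  | succ n ih =>
    rw [Nat.cast_succ, Ordinal.toZFSet_add_one]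
    exact insert_mem_constructibleLevel hβ ih ih

theorem toZFSet_natCast_injective :
    Function.Injective (fun n : ℕ => Ordinal.toZFSet (n : Ordinal.{u})) :=
  Ordinal.toZFSet_injective.comp Nat.cast_injective

theorem exists_mem_constructibleLevel_of_finset (hβ : Order.IsSuccLimit β) (F : Finset (ℕ × ℕ)) :
    ∃ c ∈ constructibleLevel β, ∀ i a : ℕ,
      ZFSet.pair (Ordinal.toZFSet (i : Ordinal.{u})) (Ordinal.toZFSet (a : Ordinal.{u})) ∈ c ↔
        (i, a) ∈ F := by
  classical
  induction F using Finset.induction_on with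
  | empty => exact ⟨∅, empty_mem_constructibleLevel hβ.bot_lt, by simp⟩
  | insert p F _ ih =>
    obtain ⟨c, hc, h⟩ := ih
    refine ⟨_, insert_mem_constructibleLevel hβ (pair_mem_constructibleLevel hβ
      (toZFSet_natCast_mem_constructibleLevel hβ p.1)
      (toZFSet_natCast_mem_constructibleLevel hβ p.2)) hc, fun i a => ?_⟩
    rw [ZFSet.mem_insert_iff, h, ZFSet.pair_inj, toZFSet_natCast_injective.eq_iff,
      toZFSet_natCast_injective.eq_iff, Finset.mem_insert, Prod.ext_iff]

theorem pair_mem_baireSet {f : ℕ → ℕ} {a b : ZFSet.{u}} :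
    ZFSet.pair a b ∈ baireSet.{u} f ↔ ∃ n : ℕ, a = Ordinal.toZFSet (n : Ordinal.{u}) ∧
      b = Ordinal.toZFSet ((f n : ℕ) : Ordinal.{u}) := by
  simp [baireSet, ZFSet.pair_inj, eq_comm]

theorem omega0_le_of_inLevel {α : Ordinal.{u}} {f : ℕ → ℕ} (hf : InLevel α f) :
    Ordinal.omega0 ≤ α := by
  refine Ordinal.omega0_le.2 fun n => ?_
  have h_mem : Ordinal.toZFSet (n : Ordinal.{u}) ∈ constructibleLevel α := by
    have hA := isTransitive_constructibleLevel α
    refine hA.mem_trans (y := {Ordinal.toZFSet n}) ?_ (hA.mem_trans ?_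
      (hA.mem_trans (pair_mem_baireSet.2 ⟨n, rfl, rfl⟩) hf))
    · exact ZFSet.mem_singleton.2 rfl
    · exact ZFSet.mem_pair.2 (.inl rfl)
  simpa using (rank_lt_of_mem_constructibleLevel h_mem).le

end ConstructibleHierarchy

section LevelArithmetic

variable {α : Ordinal.{u}} [h_nonempty : Nonempty {f : ℕ → ℕ // InLevel α f}]

include h_nonempty in
variable (α) in
theorem toZFSet_natCast_mem_of_nonempty (n : ℕ) :
    Ordinal.toZFSet (n : Ordinal.{u}) ∈ constructibleLevel α :=
  h_nonempty.elim fun f => constructibleLevel_mono (omega0_le_of_inLevel f.2)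
    (toZFSet_natCast_mem_constructibleLevel Ordinal.isSuccLimit_omega0 n)

variable (α) in
/-- The von Neumann natural number `n` as an element of `L_α`. -/
noncomputable def levelNat (n : ℕ) : {z : ZFSet.{u} // z ∈ constructibleLevel α} :=
  ⟨Ordinal.toZFSet (n : Ordinal.{u}), toZFSet_natCast_mem_of_nonempty α n⟩

theorem levelNat_injective : Function.Injective (levelNat α) := fun _ _ h =>
  toZFSet_natCast_injective (congrArg Subtype.val h)

theorem levelNat_succ (n : ℕ) :
    (levelNat α n.succ).1 = insert (levelNat α n).1 (levelNat α n).1 := by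
  simp only [levelNat, Nat.cast_succ, Ordinal.toZFSet_add_one]

theorem pair_levelNat_mem_baireSet {f : ℕ → ℕ} {n m : ℕ} :
    ZFSet.pair (levelNat α n).1 (levelNat α m).1 ∈ baireSet f ↔ f n = m := by
  simp only [pair_mem_baireSet, levelNat, toZFSet_natCast_injective.eq_iff, exists_eq_left',
    eq_comm]

variable (α) in
theorem definablePred_mem_range_levelNat :
    DefinablePred LST {z // z ∈ constructibleLevel α} (· ∈ Set.range (levelNat α)) := by
  -- `ℕ` is the domain of any `f ∈ ℕ^ℕ ∩ L_α`, which can be used as a parameter.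
  obtain ⟨f, hf⟩ := id h_nonempty
  have h : DefinablePred LST {z // z ∈ constructibleLevel α}
      fun p : {z // z ∈ constructibleLevel α} × {z // z ∈ constructibleLevel α} =>
        ZFSet.pair p.1.1 p.2.1 ∈ baireSet f :=
    .pair_mem (isTransitive_constructibleLevel α) (by fun_prop) (by fun_prop)
      (.const (⟨_, hf⟩ : {z // z ∈ constructibleLevel α}))
  refine h.exists.congr fun a => ⟨fun ⟨b, hb⟩ => ?_, fun ⟨n, hn⟩ => ⟨levelNat α (f n), ?_⟩⟩
  · obtain ⟨n, hn, -⟩ := pair_mem_baireSet.1 hb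
    exact ⟨n, Subtype.ext hn.symm⟩
  · rw [← hn, pair_levelNat_mem_baireSet]

noncomputable instance representedNat : Represented LST {z // z ∈ constructibleLevel α} ℕ where
  Index := Fin 1
  finite_index := inferInstance
  rep n _ := levelNat α n
  rep_injective _ _ h := levelNat_injective (congrFun h 0)
  definable_range := by
    have h := definablePred_mem_range_levelNat α
    rwa [DefinablePred, Set.ofPred_mem_eq, ← Set.range_comp] at h

variable {β : Type*} [Represented LST {z // z ∈ constructibleLevel α} β]

@[fun_prop]
theorem DefinableFun.levelNat {f : β → ℕ}
    (hf : DefinableFun LST {z // z ∈ constructibleLevel α} f) :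
    DefinableFun LST {z // z ∈ constructibleLevel α} fun b => levelNat α (f b) :=
  (of_reindexing (f := _root_.levelNat α) ⟨fun i => i, fun _ => rfl⟩).comp hf

instance natCoding_constructibleLevel : NatCoding LST {z // z ∈ constructibleLevel α} where
  succ := by
    have h : DefinablePred LST {z // z ∈ constructibleLevel α}
        fun p : (ℕ × ℕ) × {z // z ∈ constructibleLevel α} =>
          p.2.1 ∈ (levelNat α p.1.2).1 ↔ p.2 = levelNat α p.1.1 ∨ p.2.1 ∈ (levelNat α p.1.1).1 :=
      .iff (.mem (by fun_prop) (by fun_prop))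
        (.or (.eq (by fun_prop) (by fun_prop)) (.mem (by fun_prop) (by fun_prop)))
    refine h.forall.congr fun ⟨n, m⟩ => ?_
    have hA := isTransitive_constructibleLevel α
    rw [← (levelNat_injective (α := α)).eq_iff, eq_comm, Subtype.ext_iff, levelNat_succ (α := α),
      eq_iff_forall_mem_of_subset (hA.subset_of_mem (levelNat α m).2)
        (insert_subset_of_mem (levelNat α n).2 (hA.subset_of_mem (levelNat α n).2))]
    simp only [ZFSet.mem_insert_iff, Subtype.ext_iff]
  exists_finset_coding := by
    refine ⟨fun (c : {z // z ∈ constructibleLevel α}) i a =>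
        ZFSet.pair (levelNat α i).1 (levelNat α a).1 ∈ c.1,
      .pair_mem (isTransitive_constructibleLevel α) (by fun_prop) (by fun_prop) (by fun_prop),
      fun F => ?_⟩
    obtain ⟨f, hf⟩ := id h_nonempty
    obtain ⟨c, hc, h⟩ := exists_mem_constructibleLevel_of_finset Ordinal.isSuccLimit_omega0 F
    exact ⟨⟨c, constructibleLevel_mono (omega0_le_of_inLevel hf) hc⟩, h⟩

theorem definableFun_of_inLevel {f : ℕ → ℕ} (hf : InLevel α f) :
    DefinableFun LST {z // z ∈ constructibleLevel α} f := by
  have h : DefinablePred LST {z // z ∈ constructibleLevel α} fun p : ℕ × ℕ =>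
      ZFSet.pair (levelNat α p.1).1 (levelNat α p.2).1 ∈ baireSet f :=
    .pair_mem (isTransitive_constructibleLevel α) (by fun_prop) (by fun_prop)
      (.const (⟨_, hf⟩ : {z // z ∈ constructibleLevel α}))
  exact h.congr fun _ => pair_levelNat_mem_baireSet

theorem inLevel_add_one_of_definableFun {f : ℕ → ℕ}
    (hf : DefinableFun LST {z // z ∈ constructibleLevel α} f) : InLevel (α + 1) f := by
  have h_eq : DefinablePred LST {z // z ∈ constructibleLevel α}
      fun p : {z // z ∈ constructibleLevel α} × ℕ =>
        p.1.1 = ZFSet.pair (levelNat α p.2).1 (levelNat α (f p.2)).1 :=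
    .eq_pair (isTransitive_constructibleLevel α) (by fun_prop) (by fun_prop) (by fun_prop)
  rw [InLevel, constructibleLevel_add_one, mem_defPowerset_iff]
  refine ⟨?_, h_eq.exists.congr fun z => ?_⟩
  · intro z hz
    obtain ⟨n, rfl⟩ := ZFSet.mem_range.1 hz
    have hω := Ordinal.isSuccLimit_omega0.{u}
    obtain ⟨g, hg⟩ := h_nonempty
    exact constructibleLevel_mono (omega0_le_of_inLevel hg) (pair_mem_constructibleLevel hω
      (toZFSet_natCast_mem_constructibleLevel hω n) (toZFSet_natCast_mem_constructibleLevel hω _))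
  · simp [baireSet, eq_comm, levelNat]

end LevelArithmetic

section RealCodes

variable {L : Language} {M : Type*} [L.Structure M] [Represented L M ℕ] [NatCoding L M]
  {α : Type*} [Represented L M α]

theorem CodesReal.tendsto {f : ℕ → ℕ} {r : ℝ} (hf : CodesReal f r) :
    Tendsto (fun N : ℕ => (f 0 : ℝ) - f 1 +
        (N.rec (motive := fun _ => ℕ) 0 fun i z => 2 * z + f (i + 2) : ℕ) / (2 ^ N : ℕ))
      atTop (𝓝 r) := by
  convert (hf.2.tendsto_sum_nat.const_add ((f 0 : ℝ) - f 1)) using 1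
  · ext N
    congr 1
    induction N with
    | zero => simp
    | succ N ih =>
      rw [Finset.sum_range_succ, ← ih]
      push_cast
      field_simp
      ring
  · rw [add_sub_cancel]

@[fun_prop]
theorem DefinableFun.proj {x : ℕ → ℕ} {n m : α → ℕ} (hx : DefinableFun L M x)
    (hn : DefinableFun L M n) (hm : DefinableFun L M m) :
    DefinableFun L M fun a => proj x (n a) (m a) := by
  unfold _root_.proj
  fun_prop

theorem definableReal_of_codesReal {y : ℕ → ℕ} {Y : ℕ → ℝ} (hy : DefinableFun L M y)
    (hY : ∀ n, CodesReal (proj y n) (Y n)) : DefinableReal L M Y := by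
  have h : DefinableRat L M fun p : ℕ × ℕ => (proj y p.1 0 : ℝ) - proj y p.1 1 +
      (p.2.rec (motive := fun _ => ℕ) 0 fun i z => 2 * z + proj y p.1 (i + 2) : ℕ) /
        (2 ^ p.2 : ℕ) :=
    .add (.sub (.natCast (by fun_prop)) (.natCast (by fun_prop)))
      (.div_natCast (.natCast (by fun_prop)) (by fun_prop) fun _ => by positivity)
  exact ⟨_, h, fun n => (hY n).tendsto⟩

/-- For `c ∈ [0, 1)`, the code of `c` whose digits are those of the binary expansion that does not
end in ones. The factor `2 ^ i / 2` makes the two entries for the integer part vanish. -/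
noncomputable def binaryCode (c : ℝ) (i : ℕ) : ℕ := ⌊c * (2 ^ i / 2)⌋₊ % 2

theorem codesReal_binaryCode {c : ℝ} (hc : c ∈ Set.Ico (0 : ℝ) 1) : CodesReal (binaryCode c) c := by
  have h_zero : binaryCode c 0 = 0 := by
    rw [binaryCode, Nat.floor_eq_zero.2 (by linarith [hc.2]), Nat.zero_mod]
  have h_one : binaryCode c 1 = 0 := by
    rw [binaryCode, Nat.floor_eq_zero.2 (by linarith [hc.2]), Nat.zero_mod]
  refine ⟨fun m => Nat.lt_succ_iff.1 (Nat.mod_lt _ two_pos), ?_⟩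
  convert Real.hasSum_ofDigitsTerm_digits c one_lt_two hc using 1
  · ext m
    simp only [Real.ofDigitsTerm, Real.digits, binaryCode, Fin.val_ofNat, pow_succ, div_eq_mul_inv]
    simp
  · rw [h_zero, h_one, Nat.cast_zero, sub_zero, sub_zero]

theorem DefinableReal.definableFun_binaryCode {c : ℝ} (hc : DefinableReal L M fun _ : ℕ => c) :
    DefinableFun L M (binaryCode c) := by
  have h : DefinableRat L M fun i : ℕ => ((2 ^ i : ℕ) : ℝ) / (2 : ℕ) :=
    .div_natCast (.natCast (by fun_prop)) (by fun_prop) fun _ => two_pos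
  have h_floor := (hc.mul h.definableReal).natFloor
  push_cast at h_floor
  exact h_floor.mod (.const 2)

end RealCodes

section RationalIntervals

theorem leftEnd_lt_rightEnd (n : ℕ) : leftEnd n < rightEnd n :=
  lt_add_of_pos_right _ (by positivity)

theorem leftEnd_zero : leftEnd 0 = 0 := by
  simp [leftEnd]

theorem rightEnd_zero : rightEnd 0 = 1 := by
  simp [rightEnd, leftEnd_zero]

theorem exists_ratInterval_between {u v : ℝ} (h : u < v) :
    ∃ n, u < leftEnd n ∧ rightEnd n < v := by
  obtain ⟨k, hk⟩ := exists_nat_one_div_lt (half_pos (sub_pos.2 h))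
  have hk_pos : (0 : ℝ) < k + 1 := by positivity
  set a := ⌊u * (k + 1)⌋ + 1
  refine ⟨Nat.pair (Nat.pair a.toNat (-a).toNat) (Nat.pair k 0), ?_⟩
  have h_int : (a.toNat : ℝ) - (-a).toNat = a := by exact_mod_cast Int.toNat_sub_toNat_neg a
  have h_gt : u < a / (k + 1) := by
    rw [lt_div_iff₀ hk_pos]
    push_cast [a]
    exact Int.lt_floor_add_one _
  have h_le : (a : ℝ) / (k + 1) ≤ u + 1 / (k + 1) := by
    rw [div_le_iff₀ hk_pos, add_mul, one_div_mul_cancel hk_pos.ne']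
    push_cast [a]
    gcongr
    exact Int.floor_le _
  simp only [rightEnd, leftEnd, Nat.unpair_pair, h_int, Nat.cast_zero, zero_add]
  exact ⟨h_gt, by linarith⟩

variable {L : Language} {M : Type*} [L.Structure M] [Represented L M ℕ] [NatCoding L M]

theorem definableRat_leftEnd : DefinableRat L M leftEnd :=
  ⟨fun n => n.unpair.1.unpair.1, fun n => n.unpair.1.unpair.2, fun n => n.unpair.2.unpair.1 + 1,
    by fun_prop, by fun_prop, by fun_prop, fun n => ⟨Nat.succ_pos _, by simp [leftEnd]⟩⟩

theorem definableRat_rightEnd : DefinableRat L M rightEnd :=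
  definableRat_leftEnd.add ⟨fun n => n.unpair.2.unpair.2 + 1, fun _ => 0,
    fun n => n.unpair.2.unpair.1 + 1, by fun_prop, by fun_prop, by fun_prop,
    fun n => ⟨Nat.succ_pos _, by simp⟩⟩

end RationalIntervals

section GenericReal

/-- The closure of `I_e'` is contained in `I_e`, and translation by `Y m` maps `I_e'` into one of
the intervals whose union is the `n`-th open set coded by `x`, where `k = ⟨m, n⟩`. -/
def NestedStep (x : ℕ → ℕ) (Y : ℕ → ℝ) (k e e' : ℕ) : Prop :=
  (leftEnd e < leftEnd e' ∧ rightEnd e' < rightEnd e) ∧ ∃ j, proj x k.unpair.2 j = 1 ∧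
    leftEnd j ≤ Y k.unpair.1 + leftEnd e' ∧ Y k.unpair.1 + rightEnd e' ≤ rightEnd j

/-- The nested sequence of (indices of) rational intervals obtained from `I_0 = (0, 1)` by taking
the least possible step each time, so that it is definable. -/
noncomputable def genericSeq (x : ℕ → ℕ) (Y : ℕ → ℝ) (k : ℕ) : ℕ :=
  k.rec 0 fun k e => sInf {e' | NestedStep x Y k e e'}

/-- The point common to the intervals of `genericSeq`. -/
noncomputable def genericReal (x : ℕ → ℕ) (Y : ℕ → ℝ) : ℝ :=
  ⨆ k, leftEnd (genericSeq x Y k)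

variable {x : ℕ → ℕ} {Y : ℕ → ℝ}

variable {L : Language} {M : Type*} [L.Structure M] [Represented L M ℕ] [NatCoding L M]

theorem definablePred_nestedStep (hx : DefinableFun L M x) (hY : DefinableReal L M Y) :
    DefinablePred L M fun p : (ℕ × ℕ) × ℕ => NestedStep x Y p.1.1 p.1.2 p.2 := by
  have h_left {f : ((ℕ × ℕ) × ℕ) × ℕ → ℕ} (hf : DefinableFun L M f) :
      DefinableReal L M fun p => leftEnd (f p) := (definableRat_leftEnd.comp hf).definableReal
  have h_right {f : ((ℕ × ℕ) × ℕ) × ℕ → ℕ} (hf : DefinableFun L M f) :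
      DefinableReal L M fun p => rightEnd (f p) := (definableRat_rightEnd.comp hf).definableReal
  have h_sub : DefinablePred L M fun p : ((ℕ × ℕ) × ℕ) × ℕ => proj x p.1.1.1.unpair.2 p.2 = 1 ∧
      leftEnd p.2 ≤ Y p.1.1.1.unpair.1 + leftEnd p.1.2 ∧
        Y p.1.1.1.unpair.1 + rightEnd p.1.2 ≤ rightEnd p.2 :=
    .and (.eq (by fun_prop) (by fun_prop))
      (.and ((h_left (by fun_prop)).le ((hY.comp (by fun_prop)).add (h_left (by fun_prop))))
        (((hY.comp (by fun_prop)).add (h_right (by fun_prop))).le (h_right (by fun_prop))))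
  exact .and (.and ((definableRat_leftEnd.comp (by fun_prop)).lt
      (definableRat_leftEnd.comp (by fun_prop)))
    ((definableRat_rightEnd.comp (by fun_prop)).lt (definableRat_rightEnd.comp (by fun_prop))))
    h_sub.exists

section Density

variable (hx : ∀ n, Dense (openOfCode (proj x n)))
include hx

theorem exists_nestedStep (Y : ℕ → ℝ) (k e : ℕ) : ∃ e', NestedStep x Y k e e' := by
  obtain ⟨z, hz, hz_left, hz_right⟩ := (hx k.unpair.2).exists_between
    (add_lt_add_right (leftEnd_lt_rightEnd e) (Y k.unpair.1))
  simp only [openOfCode, ratInterval, Set.mem_iUnion₂, Set.mem_ofPred_eq] at hz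
  obtain ⟨j, hj, hj_left, hj_right⟩ := hz
  have h_lt : max (leftEnd e) (leftEnd j - Y k.unpair.1) <
      min (rightEnd e) (rightEnd j - Y k.unpair.1) := by
    apply lt_trans (b := z - Y k.unpair.1)
    · exact max_lt (by linarith) (by linarith)
    · exact lt_min (by linarith) (by linarith)
  obtain ⟨e', h_left, h_right⟩ := exists_ratInterval_between h_lt
  rw [max_lt_iff] at h_left
  rw [lt_min_iff] at h_right
  exact ⟨e', ⟨h_left.1, h_right.1⟩, j, hj, by linarith, by linarith⟩

theorem nestedStep_genericSeq (Y : ℕ → ℝ) (k : ℕ) :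
    NestedStep x Y k (genericSeq x Y k) (genericSeq x Y (k + 1)) :=
  Nat.sInf_mem (exists_nestedStep hx Y k _)

theorem monotone_leftEnd_genericSeq (Y : ℕ → ℝ) : Monotone fun k => leftEnd (genericSeq x Y k) :=
  monotone_nat_of_le_succ fun k => (nestedStep_genericSeq hx Y k).1.1.le

theorem genericReal_mem_Icc (Y : ℕ → ℝ) (k : ℕ) :
    genericReal x Y ∈ Set.Icc (leftEnd (genericSeq x Y k)) (rightEnd (genericSeq x Y k)) :=
  Set.mem_iInter.1 ((monotone_leftEnd_genericSeq hx Y).ciSup_mem_iInter_Icc_of_antitone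
    (antitone_nat_of_succ_le fun k => (nestedStep_genericSeq hx Y k).1.2.le)
    fun k => (leftEnd_lt_rightEnd (genericSeq x Y k)).le) k

theorem genericReal_mem_ratInterval (Y : ℕ → ℝ) (k : ℕ) :
    genericReal x Y ∈ ratInterval (genericSeq x Y k) :=
  ⟨(nestedStep_genericSeq hx Y k).1.1.trans_le (genericReal_mem_Icc hx Y (k + 1)).1,
    (genericReal_mem_Icc hx Y (k + 1)).2.trans_lt (nestedStep_genericSeq hx Y k).1.2⟩

theorem tendsto_leftEnd_genericSeq (Y : ℕ → ℝ) :
    Tendsto (fun k => leftEnd (genericSeq x Y k)) atTop (𝓝 (genericReal x Y)) :=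
  tendsto_atTop_ciSup (monotone_leftEnd_genericSeq hx Y)
    ⟨genericReal x Y, Set.forall_mem_range.2 fun k => (genericReal_mem_Icc hx Y k).1⟩

theorem genericReal_mem_Ico (Y : ℕ → ℝ) : genericReal x Y ∈ Set.Ico (0 : ℝ) 1 := by
  have h : genericReal x Y ∈ Set.Ioo (leftEnd 0) (rightEnd 0) := genericReal_mem_ratInterval hx Y 0
  rw [leftEnd_zero, rightEnd_zero] at h
  exact Set.Ioo_subset_Ico_self h

theorem add_genericReal_mem_gdeltaOfCode (Y : ℕ → ℝ) (m : ℕ) :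
    Y m + genericReal x Y ∈ gdeltaOfCode x := by
  refine Set.mem_iInter.2 fun n => ?_
  obtain ⟨-, j, hj, h_left, h_right⟩ := nestedStep_genericSeq hx Y (Nat.pair m n)
  obtain ⟨h_gt, h_lt⟩ := genericReal_mem_ratInterval hx Y (Nat.pair m n + 1)
  rw [Nat.unpair_pair] at hj h_left h_right
  exact Set.mem_biUnion hj ⟨by linarith, by linarith⟩

theorem definableFun_genericSeq (hx_def : DefinableFun L M x) (hY : DefinableReal L M Y) :
    DefinableFun L M (genericSeq x Y) := by
  have h := DefinableFun.nat_sInf (definablePred_nestedStep hx_def hY)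
    fun p => exists_nestedStep hx Y p.1 p.2
  exact .natRec (f := fun _ => 0) (g := fun _ k e => sInf {e' | NestedStep x Y k e e'}) (.const 0)
    (h.comp DefinableFun.id.snd) .id

theorem definableReal_genericReal (hx_def : DefinableFun L M x) (hY : DefinableReal L M Y) :
    DefinableReal L M fun _ : ℕ => genericReal x Y :=
  ⟨fun p => leftEnd (genericSeq x Y p.2),
    definableRat_leftEnd.comp ((definableFun_genericSeq hx hx_def hY).comp (by fun_prop)),
    fun _ => tendsto_leftEnd_genericSeq hx Y⟩

end Density

end GenericReal

theorem mainTheorem7_general (α : Ordinal.{u}) (y x : ℕ → ℕ) (hy : InLevel α y) (hx : InLevel α x)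
    (Y : ℕ → ℝ) (hY : ∀ n, CodesReal (proj y n) (Y n))
    (hG : ∀ n, Dense (openOfCode (proj x n))) :
    ∃ (c : ℝ) (f : ℕ → ℕ),
      (∀ m, Y m + c ∈ gdeltaOfCode x) ∧ CodesReal f c ∧ InLevel (α + 1) f := by
  have : Nonempty {f : ℕ → ℕ // InLevel α f} := ⟨x, hx⟩
  have hY_def := definableReal_of_codesReal (definableFun_of_inLevel hy) hY
  have hc_def := definableReal_genericReal hG (definableFun_of_inLevel hx) hY_def
  exact ⟨genericReal x Y, binaryCode (genericReal x Y), add_genericReal_mem_gdeltaOfCode hG Y,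
    codesReal_binaryCode (genericReal_mem_Ico hG Y),
    inLevel_add_one_of_definableFun hc_def.definableFun_binaryCode⟩

theorem mainTheorem7 (α : Ordinal.{u}) (y x : ℕ → ℕ) (hy : InLevel α y) (hx : InLevel α x)
    (Y : ℕ → ℝ) (hY : ∀ n, CodesReal (proj y n) (Y n))
    (hlim : Filter.Tendsto Y Filter.atTop (nhds (Y 0)))
    (hG : ∀ n, openOfCode (proj x n) ∈ codedOpenSupersets α) :
    ∃ (c : ℝ) (M : ℕ), Y 0 + c ∈ gdeltaOfCode x ∧ (∀ m, M < m → Y m + c ∈ gdeltaOfCode x) ∧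
      ∃ f : ℕ → ℕ, CodesReal f c ∧ InLevel (α + Ordinal.omega0) f := by
  obtain ⟨c, f, hc, hf, hfα⟩ := mainTheorem7_general α y x hy hx Y hY fun n =>
    Rat.denseRange_cast.mono (hG n).2.1
  exact ⟨c, 0, hc 0, fun m _ => hc m, f, hf,
    constructibleLevel_mono (by gcongr; exact Ordinal.one_lt_omega0.le) hfα⟩
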